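/- For a group $K$ generated by a finite set $S$, let $\gamma_{K,S}(n)$ be the number of elements of $K$ that are products of at most $n$ elements of $S\cup S^{-1}$; a finitely generated group $K$ has subexponential growth if $\lim_{n\to\infty}\gamma_{K,S}(n)^{1/n}=1$ for every finite generating set $S$ (equivalently, for one). A group has locally subexponential growth if all its finitely generated subgroups have subexponential growth. Let $\mathcal S$ be the class of groups $G$ that admit a finite chain of subgroups $$\{1\}=G^{n}\lhd G^{n-1}\lhd\cdots\lhd G^1\lhd G^0=G,$$ each normal in the preceding one $G^{i-1}$, such that $G^{i-1}/G^{i}$ has locally subexponential growth for every $i=1,\dots,n$. **Theorem A.** Every solvable group belongs to $\mathcal S$. Moreover, let $G$ be a group in $\mathcal S$ acting on $\mathbb R$ by order-preserving homeomorphisms, and suppose that some $T\in G$ has no fixed point in $\mathbb R$. Then there is a nonzero Radon measure $\mu$ on $\mathbb R$ (a Borel measure that is finite on compact sets) that is quasi-preserved by $G$: for every $g\in G$ there is a real number $\lambda_g>0$ such that $g_*\mu=\lambda_g\,\mu$, where $g_*\mu(B)=\mu(g^{-1}(B))$ for every Borel set $B$. -/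

import Mathlib

open Filter Topology MeasureTheory
open scoped Pointwise

/-- Growth function of `K` with respect to `S`: the number of elements of `K` that are products
of at most `n` elements of `S ∪ S⁻¹`. -/
noncomputable def growthFunction {K : Type*} [Group K] (S : Finset K) (n : ℕ) : ℕ :=
  ((insert 1 ((S : Set K) ∪ (S : Set K)⁻¹)) ^ n : Set K).ncard

/-- A finitely generated group has subexponential growth if its growth functions `γ` satisfy
`γ(n)^(1/n) → 1`. -/
def HasSubexponentialGrowth (K : Type*) [Group K] : Prop :=
  Group.FG K ∧ ∀ S : Finset K, Subgroup.closure (S : Set K) = ⊤ →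
    Tendsto (fun n : ℕ => (growthFunction S n : ℝ) ^ (1 / (n : ℝ))) atTop (𝓝 1)

/-- Every finitely generated subgroup has subexponential growth. -/
def HasLocallySubexponentialGrowth (K : Type*) [Group K] : Prop :=
  ∀ H : Subgroup K, H.FG → HasSubexponentialGrowth H

/-- The class `𝒮`: there is a finite chain `{1} = F n ⊴ ⋯ ⊴ F 1 ⊴ F 0 = G`, each term normal in
the preceding one, all of whose successive quotients have locally subexponential growth. -/
def InClassS (G : Type*) [Group G] : Prop :=
  ∃ (n : ℕ) (F : ℕ → Subgroup G), F 0 = ⊤ ∧ F n = ⊥ ∧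
    ∀ i < n, F (i + 1) ≤ F i ∧
      ∃ _ : ((F (i + 1)).subgroupOf (F i)).Normal,
        HasLocallySubexponentialGrowth (F i ⧸ (F (i + 1)).subgroupOf (F i))

/-- The action `ρ` quasi-preserves `μ`: for every `g` there is a real `c > 0` with `g_*μ = c μ`. -/
def QuasiPreserves {G : Type*} [Group G] (ρ : G →* (ℝ ≃ₜ ℝ)) (μ : Measure ℝ) : Prop :=
  ∀ g : G, ∃ c : ℝ, 0 < c ∧ μ.map (ρ g) = ENNReal.ofReal c • μ

/-!
Solvable groups belong to `𝒮` because abelian groups have polynomial growth. In the second part,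
subexponential growth matters only because it excludes free semigroups modulo the next term of the
series.

Let `N` be a term of the series that contains no free semigroup modulo the kernel of the action.
By ping-pong, no two conjugates of elements of `N` are crossed, and as `T` moves every point, those
conjugates that have a fixed point have a common one. On the closed invariant set of all such common
fixed points `N` acts semifreely, hence like a group of translations of `ℝ`, by Hölder's theorem.
If this group of translations is dense, then the monotone map `Φ` that conjugates `N` to it is
unique up to affine maps, so that all of `G` acts affinely through `Φ`. Otherwise `N` acts through
the powers of one translation, which commutes with the preceding term `P` of the series; then `P`
contains no free semigroup modulo the kernel either, and one climbs from `N` to `P`. When `G` itself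
is reached, it acts through `Φ` by translations. The measure is the Stieltjes measure of `Φ`.
-/

open OrderDual

section OrderedAction

variable {G X : Type*} [Group G] [MulAction G X]

theorem inv_smul_eq_self_iff {g : G} {x : X} : g⁻¹ • x = x ↔ g • x = x := by
  rw [inv_smul_eq_iff, eq_comm]

theorem conj_smul_eq_self_iff {g f : G} {x : X} :
    (g * f * g⁻¹) • x = x ↔ f • g⁻¹ • x = g⁻¹ • x := by
  rw [mul_smul, mul_smul, smul_eq_iff_eq_inv_smul]

theorem conj_smul_smul_eq_iff {g f : G} {x : X} : (g * f * g⁻¹) • g • x = g • x ↔ f • x = x := by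
  rw [conj_smul_eq_self_iff, inv_smul_smul]

theorem pow_smul_eq_self {g : G} {x : X} (h : g • x = x) (n : ℕ) : g ^ n • x = x :=
  (MulAction.stabilizer G x).pow_mem h n

instance covariantClass_smul_lt [Preorder X] [CovariantClass G X HSMul.hSMul LE.le] :
    CovariantClass G X HSMul.hSMul LT.lt where
  elim g x y h := lt_of_le_not_ge (smul_mono_right g h.le) fun h' =>
    h.not_ge (by simpa using smul_mono_right g⁻¹ h')

instance covariantClass_smul_le_orderDual [Preorder X] [CovariantClass G X HSMul.hSMul LE.le] :
    CovariantClass G Xᵒᵈ HSMul.hSMul LE.le where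
  elim g _ _ h := smul_mono_right (α := X) g h

section LinearOrder

variable [LinearOrder X] [CovariantClass G X HSMul.hSMul LE.le]

theorem smul_le_smul_iff_left {g : G} {x y : X} : g • x ≤ g • y ↔ x ≤ y :=
  (smul_strictMono_right g).le_iff_le

theorem smul_lt_smul_iff_left {g : G} {x y : X} : g • x < g • y ↔ x < y :=
  (smul_strictMono_right g).lt_iff_lt

theorem smul_le_iff_le_inv_smul {g : G} {x y : X} : g • x ≤ y ↔ x ≤ g⁻¹ • y := by
  rw [← smul_le_smul_iff_left (g := g) (y := g⁻¹ • y), smul_inv_smul]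

theorem smul_lt_iff_lt_inv_smul {g : G} {x y : X} : g • x < y ↔ x < g⁻¹ • y := by
  rw [← smul_lt_smul_iff_left (g := g) (y := g⁻¹ • y), smul_inv_smul]

theorem inv_smul_le_iff_le_smul {g : G} {x y : X} : g⁻¹ • x ≤ y ↔ x ≤ g • y := by
  rw [smul_le_iff_le_inv_smul, inv_inv]

theorem inv_smul_lt_iff_lt_smul {g : G} {x y : X} : g⁻¹ • x < y ↔ x < g • y := by
  rw [smul_lt_iff_lt_inv_smul, inv_inv]

end LinearOrder

variable [ConditionallyCompleteLinearOrder X] [CovariantClass G X HSMul.hSMul LE.le]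

theorem smul_csSup_eq_self {g : G} {s : Set X} (hne : s.Nonempty) (hb : BddAbove s)
    (hmaps : ∀ x ∈ s, g • x ∈ s) (hcof : ∀ x ∈ s, ∃ y ∈ s, x ≤ g • y) : g • sSup s = sSup s := by
  apply le_antisymm
  · exact smul_le_iff_le_inv_smul.2 <| csSup_le hne fun x hx =>
      smul_le_iff_le_inv_smul.1 (le_csSup hb (hmaps x hx))
  · refine csSup_le hne fun x hx => ?_
    obtain ⟨y, hy, hxy⟩ := hcof x hx
    exact hxy.trans (smul_mono_right g (le_csSup hb hy))

theorem exists_last_fixed {g : G} {p x : X} (hp : g • p = p) (hpx : p ≤ x) :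
    ∃ c, p ≤ c ∧ c ≤ x ∧ g • c = c ∧ ∀ y, c < y → y ≤ x → g • y ≠ y := by
  let s : Set X := {y | y ≤ x ∧ g • y = y}
  have hne : s.Nonempty := ⟨p, hpx, hp⟩
  have hb : BddAbove s := ⟨x, fun y hy => hy.1⟩
  refine ⟨sSup s, le_csSup hb ⟨hpx, hp⟩, csSup_le hne fun y hy => hy.1,
    smul_csSup_eq_self hne hb (fun y hy => ?_) fun y hy => ⟨y, hy, hy.2.ge⟩,
    fun y hy hyx h => (le_csSup hb ⟨hyx, h⟩).not_gt hy⟩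
  rwa [hy.2]

theorem exists_first_fixed {g : G} {p x : X} (hp : g • p = p) (hpx : x ≤ p) :
    ∃ b, x ≤ b ∧ b ≤ p ∧ g • b = b ∧ ∀ y, x ≤ y → y < b → g • y ≠ y := by
  obtain ⟨b, hpb, hbx, hb, hfree⟩ :=
    exists_last_fixed (X := Xᵒᵈ) (p := toDual p) (x := toDual x) hp hpx
  exact ⟨ofDual b, hbx, hpb, hb, fun y hxy hyb => hfree (toDual y) hyb hxy⟩

theorem exists_lt_pow_smul {g : G} {x y : X} (hx : x ≤ g • x)
    (hfree : ∀ z, x ≤ z → z ≤ y → g • z ≠ z) : ∃ n : ℕ, y < g ^ n • x := by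
  by_contra! hle
  let s : Set X := Set.range fun n : ℕ => g ^ n • x
  have hne : s.Nonempty := Set.range_nonempty _
  have hys : y ∈ upperBounds s := by rintro _ ⟨n, rfl⟩; exact hle n
  refine hfree (sSup s) (le_csSup ⟨y, hys⟩ ⟨0, by simp⟩) (csSup_le hne hys)
    (smul_csSup_eq_self hne ⟨y, hys⟩ ?_ ?_)
  · rintro _ ⟨n, rfl⟩
    exact ⟨n + 1, by simp only [pow_succ', mul_smul]⟩
  · rintro _ ⟨n, rfl⟩
    refine ⟨_, ⟨n, rfl⟩, ?_⟩
    rw [← mul_smul, ← pow_succ', pow_succ, mul_smul]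
    exact smul_mono_right _ hx

theorem exists_pow_smul_lt {g : G} {x y : X} (hx : g • x ≤ x)
    (hfree : ∀ z, z ≤ x → y ≤ z → g • z ≠ z) : ∃ n : ℕ, g ^ n • x < y :=
  exists_lt_pow_smul (X := Xᵒᵈ) (x := toDual x) (y := toDual y) hx
    fun z hxz hzy => hfree (ofDual z) hxz hzy

theorem lt_smul_of_forall_ne {T : G} (hT : ∀ x : X, T • x ≠ x) {x₀ : X} (h₀ : x₀ < T • x₀)
    (x : X) : x < T • x := by
  by_contra! hx
  rcases le_total x₀ x with h | h
  · let s : Set X := {y | y ≤ x ∧ y ≤ T • y}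
    exact hT _ <| smul_csSup_eq_self (s := s) ⟨x₀, h, h₀.le⟩ ⟨x, fun y hy => hy.1⟩
      (fun y hy => ⟨(smul_mono_right T hy.1).trans hx, smul_mono_right T hy.2⟩)
      fun y hy => ⟨y, hy, hy.2⟩
  · let s : Set X := {y | y ≤ x₀ ∧ T • y ≤ y}
    refine hT _ <| inv_smul_eq_self_iff.1 <| smul_csSup_eq_self (s := s) ⟨x, h, hx⟩
      ⟨x₀, fun y hy => hy.1⟩
      (fun y hy => ⟨(smul_mono_right T⁻¹ hy.1).trans (inv_smul_le_iff_le_smul.2 h₀.le), ?_⟩)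
      fun y hy => ⟨y, hy, smul_le_iff_le_inv_smul.1 hy.2⟩
    rw [smul_inv_smul]
    exact smul_le_iff_le_inv_smul.1 hy.2

theorem forall_lt_smul_or_forall_lt_inv_smul {T : G} (hT : ∀ x : X, T • x ≠ x) :
    (∀ x : X, x < T • x) ∨ ∀ x : X, x < T⁻¹ • x := by
  have x₀ : X := sSup ∅
  rcases lt_or_gt_of_ne (hT x₀) with h | h
  · exact Or.inr <| lt_smul_of_forall_ne (fun x => inv_smul_eq_self_iff.not.2 (hT x))
      (smul_lt_iff_lt_inv_smul.1 h)
  · exact Or.inl (lt_smul_of_forall_ne hT h)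

end OrderedAction

section NoFreeSemigroup

variable {G X : Type*} [Group G] [MulAction G X] {P Q : Subgroup G}

/-- No two elements of `P` generate a free semigroup modulo `Q`: any `a b ∈ P` satisfy a relation
`a * u = b * v` modulo `Q` between positive words of the same length. Requiring distinct first
letters and equal lengths loses nothing: common prefixes cancel, and a relation `w = w'` implies
`w * w' = w' * w`. -/
def NoFreeSemigroupMod (P Q : Subgroup G) : Prop :=
  ∀ a ∈ P, ∀ b ∈ P, ∃ n : ℕ, ∃ u ∈ ({a, b} : Set G) ^ n, ∃ v ∈ ({a, b} : Set G) ^ n,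
    (a * u)⁻¹ * (b * v) ∈ Q

theorem NoFreeSemigroupMod.mono_right {Q' : Subgroup G} (hPQ : NoFreeSemigroupMod P Q)
    (hQ : Q ≤ Q') : NoFreeSemigroupMod P Q' := fun a ha b hb =>
  let ⟨n, u, hu, v, hv, h⟩ := hPQ a ha b hb
  ⟨n, u, hu, v, hv, hQ h⟩

theorem NoFreeSemigroupMod.of_le (hPQ : P ≤ Q) : NoFreeSemigroupMod P Q := fun a ha b hb =>
  ⟨0, 1, rfl, 1, rfl, hPQ (by simpa using P.mul_mem (P.inv_mem ha) hb)⟩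

theorem mem_ker_toPermHom {g : G} :
    g ∈ (MulAction.toPermHom G X).ker ↔ ∀ x : X, g • x = x := by
  simp [MonoidHom.mem_ker, Equiv.ext_iff]

theorem NoFreeSemigroupMod.exists_smul_eq
    (hP : NoFreeSemigroupMod P (MulAction.toPermHom G X).ker) {a b : G} (ha : a ∈ P) (hb : b ∈ P) :
    ∃ n : ℕ, ∃ u ∈ ({a, b} : Set G) ^ n, ∃ v ∈ ({a, b} : Set G) ^ n,
      ∀ x : X, a • u • x = b • v • x := by
  obtain ⟨n, u, hu, v, hv, h⟩ := hP a ha b hb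
  refine ⟨n, u, hu, v, hv, fun x => ?_⟩
  have hx := mem_ker_toPermHom.1 h x
  rw [mul_smul, inv_smul_eq_iff, mul_smul, mul_smul] at hx
  exact hx.symm

theorem smul_mem_of_mem_pow {s : Set G} {J : Set X} (hJ : ∀ g ∈ s, ∀ x ∈ J, g • x ∈ J) :
    ∀ n : ℕ, ∀ g ∈ s ^ n, ∀ x ∈ J, g • x ∈ J
  | 0, _, rfl, x, hx => by rwa [one_smul]
  | n + 1, _, hg, x, hx => by
    rw [pow_succ] at hg
    obtain ⟨g, hg, k, hk, rfl⟩ := hg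
    rw [mul_smul]
    exact smul_mem_of_mem_pow hJ n g hg _ (hJ k hk x hx)

theorem NoFreeSemigroupMod.exists_smul_eq_of_mapsTo
    (hP : NoFreeSemigroupMod P (MulAction.toPermHom G X).ker) {a b : G} (ha : a ∈ P) (hb : b ∈ P)
    {J : Set X} (hJ : J.Nonempty) (haJ : ∀ x ∈ J, a • x ∈ J) (hbJ : ∀ x ∈ J, b • x ∈ J) :
    ∃ x ∈ J, ∃ y ∈ J, a • x = b • y := by
  obtain ⟨n, u, hu, v, hv, h⟩ := hP.exists_smul_eq ha hb
  have hw := smul_mem_of_mem_pow (s := {a, b}) (J := J) (by rintro _ (rfl | rfl) <;> assumption) n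
  obtain ⟨x, hx⟩ := hJ
  exact ⟨_, hw u hu x hx, _, hw v hv x hx, h x⟩

theorem smul_pow_succ_smul_of_mem_pow {h k : G} {q : X}
    (hfix : ∀ n : ℕ, k • h ^ (n + 1) • q = h ^ (n + 1) • q) :
    ∀ n : ℕ, ∀ u ∈ ({h⁻¹, k * h⁻¹} : Set G) ^ n, u • h ^ (n + 1) • q = h • q
  | 0, _, rfl => by rw [one_smul, zero_add, pow_one]
  | n + 1, _, hu => by
    rw [pow_succ] at hu
    obtain ⟨v, hv, c, hc, rfl⟩ := hu
    have hinv : h⁻¹ • h ^ (n + 1 + 1) • q = h ^ (n + 1) • q := by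
      rw [pow_succ' h (n + 1), mul_smul, inv_smul_smul]
    have hc : c • h ^ (n + 1 + 1) • q = h ^ (n + 1) • q := by
      rcases hc with rfl | rfl
      · exact hinv
      · rw [mul_smul, hinv, hfix]
    rw [mul_smul, hc, smul_pow_succ_smul_of_mem_pow hfix n v hv]

/-- All words of length `n` in `h⁻¹` and `k * h⁻¹` agree at `h ^ (n + 1) • q`, so a relation
between words with different first letters identifies `q` with `k • q`. -/
theorem NoFreeSemigroupMod.smul_eq_of_forall_smul_pow
    (hP : NoFreeSemigroupMod P (MulAction.toPermHom G X).ker) {h k : G} (hh : h ∈ P) (hk : k ∈ P)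
    {q : X} (hfix : ∀ n : ℕ, k • h ^ (n + 1) • q = h ^ (n + 1) • q) : k • q = q := by
  obtain ⟨n, u, hu, v, hv, huv⟩ :=
    hP.exists_smul_eq (P.inv_mem hh) (P.mul_mem hk (P.inv_mem hh))
  have hq := huv (h ^ (n + 1) • q)
  rw [smul_pow_succ_smul_of_mem_pow hfix n u hu, smul_pow_succ_smul_of_mem_pow hfix n v hv,
    mul_smul, inv_smul_smul] at hq
  exact hq.symm

theorem commutator_comm_mem {N K : Subgroup G} (hNP : ⁅N, P⁆ ≤ K) {f p : G} (hf : f ∈ N)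
    (hp : p ∈ P) : (p * f)⁻¹ * (f * p) ∈ K := by
  have h := hNP (Subgroup.commutator_mem_commutator (N.inv_mem hf) (P.inv_mem hp))
  simpa [commutatorElement_def, mul_assoc] using h

/-- If `b * v = a * u * f` with `f` central modulo `K`, then `a * u` and `b * v` commute
modulo `K`. -/
theorem NoFreeSemigroupMod.of_commutator_le {N K : Subgroup G} (hPN : NoFreeSemigroupMod P N)
    (hNP : ⁅N, P⁆ ≤ K) : NoFreeSemigroupMod P K := by
  intro a ha b hb
  obtain ⟨n, u, hu, v, hv, h⟩ := hPN a ha b hb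
  have hab : ({a, b} : Set G) ⊆ P := by rintro _ (rfl | rfl) <;> assumption
  have hau : a * u ∈ P := P.mul_mem ha (Subgroup.pow_subset hab hu)
  have hmem : ∀ c ∈ ({a, b} : Set G), ∀ w ∈ ({a, b} : Set G) ^ n, ∀ w' ∈ ({a, b} : Set G) ^ n,
      w * c * w' ∈ ({a, b} : Set G) ^ (n + 1 + n) := fun c hc w hw w' hw' => by
    rw [pow_add, pow_succ]
    exact Set.mul_mem_mul (Set.mul_mem_mul hw hc) hw'
  refine ⟨n + 1 + n, u * b * v, hmem b (by simp) u hu v hv,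
    v * a * u, hmem a (by simp) v hv u hu, ?_⟩
  convert commutator_comm_mem hNP h hau using 1
  group

/-- `N` is the last term of a finite series of subgroups of `G`, starting from `G`, in which each
term is normal in the preceding one and the preceding one contains no free semigroup modulo it. -/
inductive HasNoFreeSemigroupSeries : Subgroup G → Prop
  | top : HasNoFreeSemigroupSeries ⊤
  | step {P N : Subgroup G} (hP : HasNoFreeSemigroupSeries P) (hle : N ≤ P)
      (hnormal : (N.subgroupOf P).Normal) (hfree : NoFreeSemigroupMod P N) :
      HasNoFreeSemigroupSeries N

theorem HasNoFreeSemigroupSeries.isSubnormal {N : Subgroup G} (hN : HasNoFreeSemigroupSeries N) :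
    N.IsSubnormal := by
  induction hN with
  | top => exact .top
  | step _ hle hnormal _ ih => exact .step _ _ hle ih hnormal

end NoFreeSemigroup

section Subnormal

variable {G : Type*} [Group G] {N : Subgroup G}

theorem forall_of_isSubnormal (hN : N.IsSubnormal) {p : G → Prop} (hmem : ∀ g ∈ N, p g)
    (hstep : ∀ M : Subgroup G, N ≤ M → (∀ g ∈ M, p g) →
      ∀ g, (∀ x ∈ M, g * x * g⁻¹ ∈ M) → p g) (g : G) : p g := by
  suffices h : ∀ M : Subgroup G, M.IsSubnormal → N ≤ M → (∀ g ∈ M, p g) → ∀ g, p g from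
    h N hN le_rfl hmem g
  intro M hM
  induction hM with
  | top => exact fun _ h g => h g (Subgroup.mem_top g)
  | step M K hle _ hnormal ih =>
    refine fun hNM hM => ih (hNM.trans hle) fun g hg => hstep M hNM hM g fun x hx => ?_
    exact (Subgroup.normal_subgroupOf_iff hle).1 hnormal x g hx hg

theorem mem_conjugatesOfSet_iff_exists_conj {s : Set G} {f : G} :
    f ∈ Group.conjugatesOfSet s ↔ ∃ k ∈ s, ∃ g, g * k * g⁻¹ = f := by
  simp only [Group.mem_conjugatesOfSet_iff, isConj_iff]

theorem inv_mem_conjugatesOfSet {f : G} (hf : f ∈ Group.conjugatesOfSet (N : Set G)) :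
    f⁻¹ ∈ Group.conjugatesOfSet (N : Set G) := by
  obtain ⟨k, hk, g, rfl⟩ := mem_conjugatesOfSet_iff_exists_conj.1 hf
  exact mem_conjugatesOfSet_iff_exists_conj.2 ⟨k⁻¹, N.inv_mem hk, g, conj_inv.symm⟩

variable {X : Type*} [MulAction G X]

/-- If `k` fixes the forward orbit of `h • q`, then so does the commutator of `h` and `k` for the
orbit of `h • h • q`, which lies one step lower in the subnormal series. -/
theorem smul_eq_of_forall_smul_pow_of_isSubnormal (hN : N.IsSubnormal)
    (hfree : NoFreeSemigroupMod N (MulAction.toPermHom G X).ker) {h : G} (hh : h ∈ N) (k : G)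
    (q : X) (hfix : ∀ n : ℕ, k • h ^ (n + 1) • q = h ^ (n + 1) • q) : k • q = q := by
  revert q
  refine forall_of_isSubnormal hN
    (p := fun k => ∀ q : X, (∀ n : ℕ, k • h ^ (n + 1) • q = h ^ (n + 1) • q) → k • q = q)
    (fun k hk q => hfree.smul_eq_of_forall_smul_pow hh hk) (fun M hNM ih k hkM q hfix => ?_) k
  have hcomm : h * (k * h⁻¹ * k⁻¹) ∈ M :=
    M.mul_mem (hNM hh) (hkM _ (M.inv_mem (hNM hh)))
  have hkhq : k⁻¹ • h • q = h • q := inv_smul_eq_self_iff.2 (by simpa using hfix 0)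
  have hq := ih _ hcomm (h • q) fun n => by
    have hpow : h ^ (n + 1) • h • q = h ^ (n + 1 + 1) • q := by rw [pow_succ h (n + 1), mul_smul]
    rw [hpow, mul_smul, mul_smul, inv_smul_eq_self_iff.2 (hfix (n + 1)), mul_smul,
      pow_succ' h (n + 1), mul_smul, inv_smul_smul, hfix n]
  rw [mul_smul, mul_smul, hkhq, mul_smul, inv_smul_smul] at hq
  exact smul_left_cancel h hq

theorem smul_eq_of_forall_smul_pow_of_mem_conjugatesOfSet (hN : N.IsSubnormal)
    (hfree : NoFreeSemigroupMod N (MulAction.toPermHom G X).ker) {h : G}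
    (hh : h ∈ Group.conjugatesOfSet (N : Set G)) {k : G} {q : X}
    (hfix : ∀ n : ℕ, k • h ^ (n + 1) • q = h ^ (n + 1) • q) : k • q = q := by
  obtain ⟨k', hk', g, rfl⟩ := mem_conjugatesOfSet_iff_exists_conj.1 hh
  have hq := smul_eq_of_forall_smul_pow_of_isSubnormal hN hfree hk' (g⁻¹ * k * g) (g⁻¹ • q)
    fun n => by
      have hn := hfix n
      rw [conj_pow, mul_smul, mul_smul] at hn
      rw [mul_smul, mul_smul, hn, inv_smul_smul]
  rw [mul_smul, mul_smul, smul_inv_smul] at hq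
  exact smul_left_cancel _ hq

end Subnormal

section Crossing

variable {G : Type*} [Group G]

/-- `f` fixes the right end and `k` the left end of an interval in which they have no other
fixed point; such a pair yields a free semigroup by ping-pong. -/
def Crossed (X : Type*) [LinearOrder X] [MulAction G X] (f k : G) : Prop :=
  ∃ c b : X, c < b ∧ f • b = b ∧ k • c = c ∧ (∀ x, c ≤ x → x < b → f • x ≠ x) ∧
    ∀ x, c < x → x ≤ b → k • x ≠ x

theorem Crossed.of_orderDual {X : Type*} [LinearOrder X] [MulAction G X] {f k : G}
    (h : Crossed Xᵒᵈ f k) : Crossed X k f :=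
  let ⟨c, b, hcb, hf, hk, hffree, hkfree⟩ := h
  ⟨ofDual b, ofDual c, hcb, hk, hf, fun x hbx hxc => hkfree (toDual x) hxc hbx,
    fun x hbx hxc => hffree (toDual x) hxc hbx⟩

theorem Crossed.conj {X : Type*} [LinearOrder X] [MulAction G X]
    [CovariantClass G X HSMul.hSMul LE.le] {f k : G} (h : Crossed X f k) (g : G) :
    Crossed X (g * f * g⁻¹) (g * k * g⁻¹) := by
  obtain ⟨c, b, hcb, hf, hk, hffree, hkfree⟩ := h
  refine ⟨g • c, g • b, smul_lt_smul_iff_left.2 hcb, conj_smul_smul_eq_iff.2 hf,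
    conj_smul_smul_eq_iff.2 hk, fun x hcx hxb => ?_, fun x hcx hxb => ?_⟩
  · exact conj_smul_eq_self_iff.not.2
      (hffree _ (smul_le_iff_le_inv_smul.1 hcx) (inv_smul_lt_iff_lt_smul.2 hxb))
  · exact conj_smul_eq_self_iff.not.2
      (hkfree _ (smul_lt_iff_lt_inv_smul.1 hcx) (inv_smul_le_iff_le_smul.2 hxb))

variable {X : Type*} [ConditionallyCompleteLinearOrder X] [MulAction G X]
  [CovariantClass G X HSMul.hSMul LE.le] {N : Subgroup G}

theorem NoFreeSemigroupMod.not_crossed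
    (hfree : NoFreeSemigroupMod N (MulAction.toPermHom G X).ker) {f k : G} (hf : f ∈ N)
    (hk : k ∈ N) : ¬ Crossed X f k := by
  rintro ⟨c, b, hcb, hfb, hkc, hffree, hkfree⟩
  wlog hfc : c < f • c generalizing f
  · exact this (N.inv_mem hf) (inv_smul_eq_self_iff.2 hfb)
      (fun x hcx hxb => inv_smul_eq_self_iff.not.2 (hffree x hcx hxb))
      (smul_lt_iff_lt_inv_smul.1 (lt_of_le_of_ne (not_lt.1 hfc) (hffree c le_rfl hcb)))
  wlog hkb : k • b < b generalizing k
  · exact this (N.inv_mem hk) (inv_smul_eq_self_iff.2 hkc)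
      (fun x hcx hxb => inv_smul_eq_self_iff.not.2 (hkfree x hcx hxb))
      (inv_smul_lt_iff_lt_smul.2 (lt_of_le_of_ne (not_lt.1 hkb) (hkfree b hcb le_rfl).symm))
  obtain ⟨n, hn⟩ := exists_pow_smul_lt (y := f • c) hkb.le
    (fun z hzb hcz => hkfree z (hfc.trans_le hcz) hzb)
  have hfcb : f • c < b := by simpa only [hfb] using smul_lt_smul_iff_left (g := f).2 hcb
  have hle : ∀ x ∈ Set.Icc c b, c ≤ k ^ n • x := fun x hx => by
    simpa only [pow_smul_eq_self hkc n] using smul_mono_right (k ^ n) hx.1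
  have hlt : ∀ x ∈ Set.Icc c b, k ^ n • x < f • c := fun x hx =>
    (smul_mono_right (k ^ n) hx.2).trans_lt hn
  have hfk : ∀ x ∈ Set.Icc c b, f • c ≤ (f * k ^ n) • x := fun x hx => by
    rw [mul_smul]
    exact smul_mono_right f (hle x hx)
  obtain ⟨x, hx, y, hy, hxy⟩ := hfree.exists_smul_eq_of_mapsTo (J := Set.Icc c b)
    (N.pow_mem hk n) (N.mul_mem hf (N.pow_mem hk n)) ⟨c, le_rfl, hcb.le⟩
    (fun x hx => ⟨hle x hx, ((hlt x hx).trans hfcb).le⟩)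
    (fun x hx => ⟨hfc.le.trans (hfk x hx), by
      simpa only [mul_smul, hfb] using smul_mono_right f ((hlt x hx).trans hfcb).le⟩)
  exact ((hlt x hx).trans_le (hfk y hy)).ne hxy

/-- Otherwise `f` fixes the whole forward `h`-orbit of `b`, hence also `h⁻¹ • b`. -/
theorem exists_crossed_conj_pow (hN : N.IsSubnormal)
    (hfree : NoFreeSemigroupMod N (MulAction.toPermHom G X).ker) {f h : G}
    (hh : h ∈ Group.conjugatesOfSet (N : Set G)) {b : X} (hfb : f • b = b) (hb : b < h • b)
    {s : Set X} (hs : IsUpperSet s) (hinv : ∀ x ∈ s, h⁻¹ • x ∈ s) (hbs : b ∈ s)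
    (hfs : ∀ x ∈ s, x < b → f • x ≠ x) : ∃ n : ℕ, Crossed X (h ^ n * f * (h ^ n)⁻¹) f := by
  by_contra! hcr
  have hfix : ∀ n : ℕ, f • h ^ n • b = h ^ n • b := by
    intro n
    by_contra hne
    obtain ⟨c, hbc, hcn, hfc, hcfree⟩ := exists_last_fixed hfb (le_pow_smul hb.le n)
    have hlt : c < h ^ n • b := lt_of_le_of_ne hcn fun h => hne (h ▸ hfc)
    refine hcr n ⟨c, h ^ n • b, hlt, conj_smul_smul_eq_iff.2 hfb, hfc, fun x hcx hxn => ?_, hcfree⟩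
    have hxs : (h ^ n)⁻¹ • x ∈ s :=
      smul_mem_of_mem_pow (s := {h⁻¹}) (by rintro _ rfl; exact hinv) n _ (by simp) x
        (hs (hbc.trans hcx) hbs)
    exact conj_smul_eq_self_iff.not.2 (hfs _ hxs (inv_smul_lt_iff_lt_smul.2 hxn))
  refine hfs _ (hinv b hbs) (inv_smul_lt_iff_lt_smul.2 hb)
    (smul_eq_of_forall_smul_pow_of_mem_conjugatesOfSet hN hfree hh fun n => ?_)
  rw [pow_succ, mul_smul, smul_inv_smul]
  exact hfix n

theorem not_crossed_conj_of_isSubnormal (hN : N.IsSubnormal)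
    (hfree : NoFreeSemigroupMod N (MulAction.toPermHom G X).ker) (g : G) :
    ∀ f ∈ N, ∀ k ∈ N, ¬ Crossed X f (g * k * g⁻¹) := by
  refine forall_of_isSubnormal hN (p := fun g => ∀ f ∈ N, ∀ k ∈ N, ¬ Crossed X f (g * k * g⁻¹))
    (fun g hg f hf k hk => hfree.not_crossed hf (N.mul_mem (N.mul_mem hg hk) (N.inv_mem hg)))
    (fun M hNM ih g hgM f hf k hk => ?_) g
  rintro ⟨c, b, hcb, hfb, hkc, hffree, hkfree⟩
  wlog hkb : b < (g * k * g⁻¹) • b generalizing k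
  · refine this k⁻¹ (N.inv_mem hk) ?_ ?_ ?_ <;> rw [← conj_inv]
    · exact inv_smul_eq_self_iff.2 hkc
    · exact fun x hcx hxb => inv_smul_eq_self_iff.not.2 (hkfree x hcx hxb)
    · exact smul_lt_iff_lt_inv_smul.1 (lt_of_le_of_ne (not_lt.1 hkb) (hkfree b hcb le_rfl))
  set h := g * k * g⁻¹
  have hhN : h ∈ Group.conjugatesOfSet (N : Set G) :=
    Group.conj_mem_conjugatesOfSet (Group.subset_conjugatesOfSet hk)
  have hhM : h ∈ M := hgM k (hNM hk)
  obtain ⟨n, hcr⟩ := exists_crossed_conj_pow hN hfree hhN hfb hkb (isUpperSet_Ici c)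
    (fun x hx => smul_le_iff_le_inv_smul.1 (hkc.trans_le hx))
    hcb.le hffree
  refine ih (h ^ n)⁻¹ (M.inv_mem (M.pow_mem hhM n)) f hf f hf ?_
  convert hcr.conj (h ^ n)⁻¹ using 1
  group

theorem not_crossed_of_mem_conjugatesOfSet (hN : N.IsSubnormal)
    (hfree : NoFreeSemigroupMod N (MulAction.toPermHom G X).ker) {f k : G}
    (hf : f ∈ Group.conjugatesOfSet (N : Set G)) (hk : k ∈ Group.conjugatesOfSet (N : Set G)) :
    ¬ Crossed X f k := by
  obtain ⟨f₀, hf₀, g, rfl⟩ := mem_conjugatesOfSet_iff_exists_conj.1 hf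
  obtain ⟨k₀, hk₀, g', rfl⟩ := mem_conjugatesOfSet_iff_exists_conj.1 hk
  intro hcr
  refine not_crossed_conj_of_isSubnormal hN hfree (g⁻¹ * g') f₀ hf₀ k₀ hk₀ ?_
  convert hcr.conj g⁻¹ using 1 <;> group

theorem exists_gt_smul_eq_self (hN : N.IsSubnormal)
    (hfree : NoFreeSemigroupMod N (MulAction.toPermHom G X).ker) {T : G} {f : G}
    (hf : f ∈ Group.conjugatesOfSet (N : Set G)) {a : X} (ha : f • a = a) (hT : a < T • a) :
    ∃ y, a < y ∧ f • y = y := by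
  by_contra! hright
  have hf' : T * f * T⁻¹ ∈ Group.conjugatesOfSet (N : Set G) := Group.conj_mem_conjugatesOfSet hf
  have hright' : ∀ y, T • a < y → (T * f * T⁻¹) • y ≠ y := fun y hy =>
    conj_smul_eq_self_iff.not.2 (hright _ (smul_lt_iff_lt_inv_smul.1 hy))
  obtain ⟨h, hh, hlt⟩ : ∃ h ∈ Group.conjugatesOfSet (N : Set G), h • T • a < T • a := by
    rcases lt_or_gt_of_ne (hright _ hT) with h | h
    · exact ⟨f, hf, h⟩
    · exact ⟨f⁻¹, inv_mem_conjugatesOfSet hf, inv_smul_lt_iff_lt_smul.2 h⟩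
  obtain ⟨n, hcr⟩ := exists_crossed_conj_pow (X := Xᵒᵈ) hN hfree hh (b := toDual (T • a))
    (conj_smul_smul_eq_iff.2 ha) hlt isUpperSet_univ (fun _ _ => trivial) trivial
    fun y _ hy => hright' (ofDual y) hy
  exact not_crossed_of_mem_conjugatesOfSet hN hfree hf' (Group.conj_mem_conjugatesOfSet hf')
    hcr.of_orderDual

/-- If `f` has no fixed point in `[x, T • x]`, then `f` and its conjugate by `T` are crossed
between `T • a` and `b`, where `a` is the last fixed point of `f` before `x` and `b` the first one
after `T • x`. -/
theorem exists_smul_eq_self_mem_Icc_of_lt (hN : N.IsSubnormal)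
    (hfree : NoFreeSemigroupMod N (MulAction.toPermHom G X).ker) {T : G}
    (hT : ∀ x : X, x < T • x) {f : G} (hf : f ∈ Group.conjugatesOfSet (N : Set G)) {p x : X}
    (hp : f • p = p) (hpx : p < x) : ∃ y ∈ Set.Icc x (T • x), f • y = y := by
  by_contra! hIcc
  obtain ⟨a, -, hax, hfa, hafree⟩ := exists_last_fixed hp hpx.le
  have hax' : a < x := lt_of_le_of_ne hax fun h => hIcc x ⟨le_rfl, (hT x).le⟩ (h ▸ hfa)
  obtain ⟨z, haz, hfz⟩ := exists_gt_smul_eq_self hN hfree hf hfa (hT a)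
  have hz : T • x ≤ z := by
    by_contra! hz
    exact (le_total z x).elim (hafree z haz · hfz) fun h => hIcc z ⟨h, hz.le⟩ hfz
  obtain ⟨b, hxb, -, hfb, hbfree⟩ := exists_first_fixed hfz hz
  have hab : ∀ y, a < y → y < b → f • y ≠ y := fun y hay hyb => by
    rcases le_total y x with hyx | hxy
    · exact hafree y hay hyx
    · exact (le_total y (T • x)).elim (fun h => hIcc y ⟨hxy, h⟩) fun h => hbfree y h hyb
  refine not_crossed_of_mem_conjugatesOfSet hN hfree hf (Group.conj_mem_conjugatesOfSet hf)
    ⟨T • a, b, (smul_lt_smul_iff_left.2 hax').trans_le hxb, hfb,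
      conj_smul_smul_eq_iff.2 hfa, fun y hay hyb => hab y ((hT a).trans_le hay) hyb,
      fun y hay hyb => conj_smul_eq_self_iff.not.2 (hab _ (smul_lt_iff_lt_inv_smul.1 hay) ?_)⟩
  exact inv_smul_lt_iff_lt_smul.2 (hyb.trans_lt (hT b))

theorem exists_smul_eq_self_mem_Icc (hN : N.IsSubnormal)
    (hfree : NoFreeSemigroupMod N (MulAction.toPermHom G X).ker) {T : G}
    (hT : ∀ x : X, x < T • x) {f : G} (hf : f ∈ Group.conjugatesOfSet (N : Set G)) {p : X}
    (hp : f • p = p) (x : X) : ∃ y ∈ Set.Icc x (T • x), f • y = y := by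
  rcases lt_or_ge p x with hpx | hxp
  · exact exists_smul_eq_self_mem_Icc_of_lt hN hfree hT hf hp hpx
  rcases lt_or_ge (T • x) p with hTp | hpT
  · obtain ⟨y, ⟨hy, hy'⟩, hfy⟩ := exists_smul_eq_self_mem_Icc_of_lt (X := Xᵒᵈ) hN hfree
      (T := T⁻¹) (x := toDual (T • x)) (p := toDual p)
      (fun z => inv_smul_lt_iff_lt_smul (X := X).2 (hT _)) hf hp hTp
    exact ⟨ofDual y, ⟨(inv_smul_smul T x).symm.le.trans hy', hy⟩, hfy⟩
  · exact ⟨p, ⟨hxp, hpT⟩, hp⟩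

/-- The supremum `r` of the first fixed points after `x` is fixed: an `f` moving `r` would be
crossed with an element whose first fixed point comes between the last fixed point of `f` before
`r` and `r`. -/
theorem exists_forall_smul_eq_self (hN : N.IsSubnormal)
    (hfree : NoFreeSemigroupMod N (MulAction.toPermHom G X).ker) {T : G}
    (hT : ∀ x : X, x < T • x) :
    ∃ r : X, ∀ f ∈ Group.conjugatesOfSet (N : Set G), (∃ p : X, f • p = p) → f • r = r := by
  have x : X := sSup ∅
  let s : Set X := {b | b ∈ Set.Icc x (T • x) ∧ ∃ f ∈ Group.conjugatesOfSet (N : Set G),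
    f • b = b ∧ ∀ y, x ≤ y → y < b → f • y ≠ y}
  have hbdd : BddAbove s := ⟨T • x, fun b hb => hb.1.2⟩
  refine ⟨sSup s, fun f hf ⟨p, hp⟩ => ?_⟩
  by_contra hne
  obtain ⟨y, ⟨hxy, hyT⟩, hfy⟩ := exists_smul_eq_self_mem_Icc hN hfree hT hf hp x
  obtain ⟨a, hxa, hay, hfa, hafree⟩ := exists_first_fixed hfy hxy
  have has : a ∈ s := ⟨⟨hxa, hay.trans hyT⟩, f, hf, hfa, hafree⟩
  obtain ⟨c, hac, hcr, hfc, hcfree⟩ := exists_last_fixed hfa (le_csSup hbdd has)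
  obtain ⟨b, hb, hcb⟩ :=
    exists_lt_of_lt_csSup ⟨a, has⟩ (lt_of_le_of_ne hcr fun h => hne (h ▸ hfc))
  have hbr : b ≤ sSup s := le_csSup hbdd hb
  obtain ⟨-, f', hf', hf'b, hf'free⟩ := hb
  exact not_crossed_of_mem_conjugatesOfSet hN hfree hf' hf ⟨c, b, hcb, hf'b, hfc,
    fun y hcy => hf'free y ((hxa.trans hac).trans hcy),
    fun y hcy hyb => hcfree y hcy (hyb.trans hbr)⟩

end Crossing

section Holder

variable {G : Type*} [Group G] [LinearOrder G] [MulLeftMono G] [MulRightMono G]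

theorem exists_zpow_le_lt_zpow_add_one (harch : ∀ x y : G, 1 < y → ∃ n : ℕ, x ≤ y ^ n) {d : G}
    (hd : 1 < d) (x : G) : ∃ k : ℤ, d ^ k ≤ x ∧ x < d ^ (k + 1) := by
  have hmono : StrictMono fun k : ℤ => d ^ k := strictMono_int_of_lt_succ fun k => by
    rw [zpow_add_one]
    exact lt_mul_of_one_lt_right' _ hd
  obtain ⟨n, hn⟩ := harch x d hd
  obtain ⟨m, hm⟩ := harch x⁻¹ d hd
  obtain ⟨k, hk, hmax⟩ := Int.exists_greatest_of_bdd (P := fun k : ℤ => d ^ k ≤ x)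
    ⟨n, fun z hz => hmono.le_iff_le.1 (hz.trans (by simpa using hn))⟩
    ⟨-m, by simpa using inv_le_of_inv_le' hm⟩
  exact ⟨k, hk, lt_of_not_ge fun h => (hmax _ h).not_gt (lt_add_one k)⟩

theorem exists_zpow_eq_of_isLeast (harch : ∀ x y : G, 1 < y → ∃ n : ℕ, x ≤ y ^ n) {d : G}
    (hd : IsLeast (Set.Ioi 1) d) (x : G) : ∃ k : ℤ, d ^ k = x := by
  obtain ⟨k, hk, hk'⟩ := exists_zpow_le_lt_zpow_add_one harch hd.1 x
  refine ⟨k, hk.eq_of_not_lt fun hlt => ?_⟩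
  have hle : d ≤ (d ^ k)⁻¹ * x := hd.2 (Set.mem_Ioi.2 (lt_inv_mul_iff_lt.2 hlt))
  rw [le_inv_mul_iff_mul_le, ← zpow_add_one] at hle
  exact hle.not_gt hk'

theorem exists_one_lt_mul_self_le (h : ¬ ∃ d : G, IsLeast (Set.Ioi 1) d) {c : G} (hc : 1 < c) :
    ∃ d : G, 1 < d ∧ d * d ≤ c := by
  obtain ⟨e, he, hec⟩ : ∃ e : G, 1 < e ∧ e < c := by
    by_contra! hle
    exact h ⟨c, hc, hle⟩
  have he' : 1 < e⁻¹ * c := lt_inv_mul_iff_lt.2 hec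
  rcases le_total e (e⁻¹ * c) with hle | hle
  · exact ⟨e, he, le_inv_mul_iff_mul_le.1 hle⟩
  · exact ⟨e⁻¹ * c, he', (mul_le_mul_left hle _).trans (mul_inv_cancel_left e c).le⟩

/-- If `d ^ k ≤ a < d ^ (k + 1)` and `d ^ l ≤ b < d ^ (l + 1)`, then the commutator of `a` and `b`
is less than `d * d`. -/
theorem mul_comm_of_forall_exists_le_pow (harch : ∀ x y : G, 1 < y → ∃ n : ℕ, x ≤ y ^ n)
    (a b : G) : a * b = b * a := by
  by_cases hleast : ∃ d : G, IsLeast (Set.Ioi 1) d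
  · obtain ⟨d, hd⟩ := hleast
    obtain ⟨k, rfl⟩ := exists_zpow_eq_of_isLeast harch hd a
    obtain ⟨l, rfl⟩ := exists_zpow_eq_of_isLeast harch hd b
    exact (Commute.refl d).zpow_zpow k l
  wlog hlt : b * a < a * b generalizing a b
  · exact (not_lt.1 hlt).eq_of_not_lt fun h => h.ne' (this b a h)
  obtain ⟨d, hd, hdd⟩ := exists_one_lt_mul_self_le hleast (lt_inv_mul_iff_lt.2 hlt)
  obtain ⟨k, hka, hak⟩ := exists_zpow_le_lt_zpow_add_one harch hd a
  obtain ⟨l, hlb, hbl⟩ := exists_zpow_le_lt_zpow_add_one harch hd b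
  refine absurd (le_inv_mul_iff_mul_le.1 hdd) (not_le.2 ?_)
  calc a * b < d ^ (k + 1) * d ^ (l + 1) := mul_lt_mul_of_lt_of_lt hak hbl
    _ = d ^ l * d ^ k * (d * d) := by group
    _ ≤ b * a * (d * d) := mul_le_mul_left (mul_le_mul' hlb hka) _

end Holder

section Semifree

variable {G X : Type*} [Group G] [MulAction G X]

variable (G X) in
/-- An action is semifree if every element with a fixed point acts trivially. -/
def IsSemifreeAction : Prop :=
  ∀ (g : G) (p : X), g • p = p → ∀ x : X, g • x = x

/-- `τ` records the order between the translates of each point, as the amounts by which the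
elements of a group of translations of `ℝ` translate. -/
def IsTranslationHom (X : Type*) [LE X] [MulAction G X] (τ : Additive G →+ ℝ) : Prop :=
  ∀ (f g : G) (x : X), τ (.ofMul f) ≤ τ (.ofMul g) ↔ f • x ≤ g • x

theorem IsTranslationHom.map_pos_iff [LinearOrder X] {τ : Additive G →+ ℝ}
    (hτ : IsTranslationHom X τ) (g : G) (x : X) : 0 < τ (.ofMul g) ↔ x < g • x := by
  simpa using (hτ g 1 x).not

theorem IsTranslationHom.smul_eq [PartialOrder X] {τ : Additive G →+ ℝ}
    (hτ : IsTranslationHom X τ) {f g : G} (h : τ (.ofMul f) = τ (.ofMul g)) (x : X) :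
    f • x = g • x :=
  le_antisymm ((hτ f g x).1 h.le) ((hτ g f x).1 h.ge)

variable [ConditionallyCompleteLinearOrder X] [CovariantClass G X HSMul.hSMul LE.le]

theorem exists_lt_pow_smul_of_forall_lt {T : G} (hT : ∀ x : X, x < T • x) (y x : X) :
    ∃ n : ℕ, x < T ^ n • y :=
  exists_lt_pow_smul (hT y).le fun z _ _ => (hT z).ne'

theorem exists_inv_pow_smul_lt {T : G} (hT : ∀ x : X, x < T • x) (y x : X) :
    ∃ n : ℕ, (T ^ n)⁻¹ • y < x := by
  obtain ⟨n, hn⟩ := exists_lt_pow_smul_of_forall_lt hT x y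
  exact ⟨n, inv_smul_lt_iff_lt_smul.2 hn⟩

theorem IsSemifreeAction.lt_smul (hG : IsSemifreeAction G X) {d : G} {y : X} (hd : y < d • y)
    (x : X) : x < d • x :=
  lt_smul_of_forall_ne (fun p hp => hd.ne' (hG d p hp y)) hd x

theorem IsSemifreeAction.smul_le_smul (hG : IsSemifreeAction G X) {f g : G} {y : X}
    (h : f • y ≤ g • y) (x : X) : f • x ≤ g • x := by
  contrapose! h
  have hx : x < (g⁻¹ * f) • x := by
    rw [mul_smul]
    exact smul_lt_iff_lt_inv_smul.1 h
  rw [smul_lt_iff_lt_inv_smul, ← mul_smul]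
  exact hG.lt_smul hx y

/-- Hölder's theorem: a faithful semifree action orders the group by its orbits, and this order
is Archimedean because fixed-point-free elements have unbounded orbits. -/
theorem IsSemifreeAction.exists_isTranslationHom_of_faithful [FaithfulSMul G X]
    (hG : IsSemifreeAction G X) : ∃ τ : Additive G →+ ℝ, IsTranslationHom X τ := by
  have y : X := sSup ∅
  let _ : LinearOrder G := LinearOrder.lift' (fun g : G => g • y) fun f g h => by
    refine eq_of_smul_eq_smul fun x : X => le_antisymm ?_ ?_
    exacts [hG.smul_le_smul h.le x, hG.smul_le_smul h.ge x]
  have hle : ∀ f g : G, f ≤ g ↔ f • y ≤ g • y := fun _ _ => Iff.rfl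
  have : MulLeftMono G := ⟨fun k f g h => by
    rw [hle, mul_smul, mul_smul]
    exact smul_mono_right k h⟩
  have : MulRightMono G := ⟨fun k f g h => by
    simp only [Function.swap, hle, mul_smul]
    exact hG.smul_le_smul h _⟩
  have harch : ∀ f d : G, 1 < d → ∃ n : ℕ, f ≤ d ^ n := fun f d hd => by
    have hd : (1 : G) • y < d • y := hd
    obtain ⟨n, hn⟩ :=
      exists_lt_pow_smul_of_forall_lt (hG.lt_smul (by rwa [one_smul] at hd)) y (f • y)
    exact ⟨n, hn.le⟩
  let _ : CommGroup G :=
    { (inferInstance : Group G) with mul_comm := mul_comm_of_forall_exists_le_pow harch }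
  have : IsOrderedMonoid G := { mul_le_mul_left := fun f g h k => mul_le_mul_left h k }
  have : MulArchimedean G := ⟨fun f d hd => harch f d hd⟩
  obtain ⟨τ, hτ⟩ := Archimedean.exists_orderAddMonoidHom_real_injective (Additive G)
  refine ⟨τ, fun f g x => ((τ.monotone'.strictMono_of_injective hτ).le_iff_le).trans ?_⟩
  exact ⟨fun h => hG.smul_le_smul h x, fun h => hG.smul_le_smul h y⟩

theorem IsSemifreeAction.exists_isTranslationHom (hG : IsSemifreeAction G X) :
    ∃ τ : Additive G →+ ℝ, IsTranslationHom X τ := by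
  let φ : G →* (MulAction.toPermHom G X).range := (MulAction.toPermHom G X).rangeRestrict
  have hφ : Function.Surjective φ := MonoidHom.rangeRestrict_surjective _
  have : CovariantClass (MulAction.toPermHom G X).range X HSMul.hSMul LE.le :=
    ⟨hφ.forall.2 fun g _ _ h => smul_mono_right g h⟩
  obtain ⟨τ, hτ⟩ := IsSemifreeAction.exists_isTranslationHom_of_faithful
    (G := (MulAction.toPermHom G X).range) (X := X) (hφ.forall.2 fun g => hG g)
  exact ⟨τ.comp (MonoidHom.toAdditive φ), fun f g x => hτ (φ f) (φ g) x⟩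

end Semifree

section Developing

theorem nonpos_of_forall_nat_mul_le {x C : ℝ} (h : ∀ n : ℕ, n * x ≤ C) : x ≤ 0 := by
  by_contra! hx
  obtain ⟨n, hn⟩ := exists_nat_gt (C / x)
  exact (h n).not_gt ((div_lt_iff₀ hx).1 hn)

/-- Compare `n • a` with the multiple `⌈n * φ a / φ t⌉ • t` and divide by `n`. -/
theorem addMonoidHom_eq_mul_of_nonneg_imp {A : Type*} [AddGroup A] {φ ψ : A →+ ℝ}
    (h : ∀ a, 0 ≤ φ a → 0 ≤ ψ a) {t : A} (ht : 0 < φ t) (a : A) : ψ a = ψ t / φ t * φ a := by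
  suffices hle : ∀ a, ψ a ≤ ψ t / φ t * φ a by
    have hneg := hle (-a)
    simp only [map_neg, mul_neg, neg_le_neg_iff] at hneg
    exact le_antisymm (hle a) hneg
  intro a
  rw [← sub_nonpos]
  refine nonpos_of_forall_nat_mul_le (C := ψ t) fun n => ?_
  have hk : n * φ a ≤ ⌈n * φ a / φ t⌉ * φ t := (div_le_iff₀ ht).1 (Int.le_ceil _)
  have hψ := h (⌈n * φ a / φ t⌉ • t - n • a) (by simpa using hk)
  have hk' := mul_le_mul_of_nonneg_right (Int.ceil_lt_add_one (n * φ a / φ t)).le (h t ht.le)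
  calc n * (ψ a - ψ t / φ t * φ a) = n * ψ a - n * φ a / φ t * ψ t := by ring
    _ ≤ ⌈n * φ a / φ t⌉ * ψ t - n * φ a / φ t * ψ t := sub_le_sub_right (by simpa using hψ) _
    _ ≤ ψ t := by linarith

variable {G X : Type*} [Group G] [MulAction G X]

/-- A monotone map to `ℝ` that turns the action into the translations by `τ`. -/
structure IsDevelopingMap [Preorder X] (τ : Additive G →+ ℝ) (Φ : X → ℝ) : Prop where
  monotone : Monotone Φ
  map_smul (g : G) (x : X) : Φ (g • x) = Φ x + τ (.ofMul g)

/-- `Φ` turns the action of `g` into an increasing affine map of `ℝ`. -/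
def ActsAffinely (Φ : X → ℝ) (g : G) : Prop :=
  ∃ l : ℝ, 0 < l ∧ ∃ c, ∀ x, Φ (g • x) = l * Φ x + c

variable (G X) in
/-- There is a nonconstant monotone map to `ℝ` that turns the action into an affine one; its
Stieltjes measure is quasi-preserved. -/
def HasAffineDevelopingMap [Preorder X] : Prop :=
  ∃ Φ : X → ℝ, Monotone Φ ∧ (∃ x y, Φ x ≠ Φ y) ∧ ∀ g : G, ActsAffinely Φ g

theorem IsDevelopingMap.actsAffinely [Preorder X] {τ : Additive G →+ ℝ} {Φ : X → ℝ}
    (hΦ : IsDevelopingMap τ Φ) (g : G) : ActsAffinely Φ g :=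
  ⟨1, one_pos, τ (.ofMul g), fun x => by rw [one_mul, hΦ.map_smul]⟩

theorem IsDevelopingMap.exists_lt_and_exists_gt [Preorder X] [Nonempty X] {τ : Additive G →+ ℝ}
    {Φ : X → ℝ} (hΦ : IsDevelopingMap τ Φ) {T : G} (hT : 0 < τ (.ofMul T)) (t : ℝ) :
    (∃ x, Φ x < t) ∧ ∃ x, t < Φ x := by
  obtain ⟨y⟩ := ‹Nonempty X›
  have hpow : ∀ k : ℤ, Φ (T ^ k • y) = Φ y + k * τ (.ofMul T) := fun k => by
    rw [hΦ.map_smul, ofMul_zpow, map_zsmul, zsmul_eq_mul]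
  obtain ⟨m, hm⟩ := exists_int_lt ((t - Φ y) / τ (.ofMul T))
  obtain ⟨n, hn⟩ := exists_int_gt ((t - Φ y) / τ (.ofMul T))
  rw [lt_div_iff₀ hT] at hm
  rw [div_lt_iff₀ hT] at hn
  exact ⟨⟨T ^ m • y, by linarith [hpow m]⟩, ⟨T ^ n • y, by linarith [hpow n]⟩⟩

theorem IsDevelopingMap.exists_ne [Preorder X] [Nonempty X] {τ : Additive G →+ ℝ} {Φ : X → ℝ}
    (hΦ : IsDevelopingMap τ Φ) {T : G} (hT : 0 < τ (.ofMul T)) : ∃ x y, Φ x ≠ Φ y :=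
  let ⟨⟨x, hx⟩, y, hy⟩ := hΦ.exists_lt_and_exists_gt hT 0
  ⟨x, y, (hx.trans hy).ne⟩

theorem exists_addMonoidHom_of_forall_exists_add [Nonempty X] {Ψ : X → ℝ}
    (h : ∀ g : G, ∃ c, ∀ x, Ψ (g • x) = Ψ x + c) :
    ∃ τ : Additive G →+ ℝ, ∀ (g : G) (x : X), Ψ (g • x) = Ψ x + τ (.ofMul g) := by
  obtain ⟨y⟩ := ‹Nonempty X›
  choose c hc using h
  refine ⟨AddMonoidHom.mk' (fun g => c g.toMul) fun f g => ?_, hc⟩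
  have hfg := hc (f.toMul * g.toMul) y
  rw [mul_smul, hc, hc] at hfg
  simp only [toMul_add]
  linarith

/-- A monotone map equivariant for a dense group of translations is determined up to an affine
map. -/
theorem IsDevelopingMap.exists_eq_mul_add [LinearOrder X] [Nonempty X]
    {τ : Additive G →+ ℝ} (hτ : IsTranslationHom X τ)
    (hdense : Dense (Set.range τ)) {T : G} (hT : 0 < τ (.ofMul T)) {Φ : X → ℝ}
    (hΦ : IsDevelopingMap τ Φ) {τ' : Additive G →+ ℝ} {Ψ : X → ℝ} (hΨ : IsDevelopingMap τ' Ψ)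
    (hne : ∃ x y, Ψ x ≠ Ψ y) : ∃ l : ℝ, 0 < l ∧ ∃ c, ∀ x, Ψ x = l * Φ x + c := by
  obtain ⟨y₀⟩ := ‹Nonempty X›
  have hnonneg : ∀ f : Additive G, 0 ≤ τ f → 0 ≤ τ' f := fun f hf => by
    have hle : y₀ ≤ f.toMul • y₀ := by simpa using (hτ 1 f.toMul y₀).1 (by simpa using hf)
    have := hΨ.monotone hle
    rwa [hΨ.map_smul, ofMul_toMul, le_add_iff_nonneg_right] at this
  obtain ⟨l, hl, hτ'⟩ : ∃ l : ℝ, 0 ≤ l ∧ ∀ f, τ' f = l * τ f :=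
    ⟨_, div_nonneg (hnonneg _ hT.le) hT.le, addMonoidHom_eq_mul_of_nonneg_imp hnonneg hT⟩
  have hclosed : ∀ x y : X, IsClosed {t : ℝ | Ψ x - Ψ y ≤ l * t} := fun x y =>
    isClosed_le (by fun_prop) (by fun_prop)
  have hsub : ∀ x y : X, Ψ x - Ψ y ≤ l * (Φ x - Φ y) := fun x y => by
    have hmem : Φ x - Φ y ∈ closure (Set.Ioi (Φ x - Φ y) ∩ Set.range τ) :=
      closure_minimal (hdense.open_subset_closure_inter isOpen_Ioi) isClosed_closure <| by
        rw [closure_Ioi]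
        exact Set.self_mem_Ici
    refine closure_minimal ?_ (hclosed x y) hmem
    rintro _ ⟨hlt, f, rfl⟩
    have hxy : x ≤ f.toMul • y := le_of_not_ge fun hfy => by
      have := hΦ.monotone hfy
      rw [hΦ.map_smul, ofMul_toMul] at this
      linarith [Set.mem_Ioi.1 hlt]
    have := hΨ.monotone hxy
    rw [hΨ.map_smul, ofMul_toMul, hτ'] at this
    exact sub_le_iff_le_add'.2 this
  have hΨΦ : ∀ x y, Ψ x - Ψ y = l * (Φ x - Φ y) := fun x y =>
    (hsub x y).antisymm (by linarith [hsub y x])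
  obtain ⟨x, y, hxy⟩ := hne
  have hl0 : l ≠ 0 := fun h0 => hxy (sub_eq_zero.1 (by rw [hΨΦ, h0, zero_mul]))
  exact ⟨l, lt_of_le_of_ne hl hl0.symm, Ψ y₀ - l * Φ y₀, fun x => by linarith [hΨΦ x y₀]⟩

section Order

variable [ConditionallyCompleteLinearOrder X] [CovariantClass G X HSMul.hSMul LE.le]

theorem IsTranslationHom.exists_isDevelopingMap {τ : Additive G →+ ℝ} (hτ : IsTranslationHom X τ)
    {T : G} (hT : ∀ x : X, x < T • x) : ∃ Φ : X → ℝ, IsDevelopingMap τ Φ := by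
  have y : X := sSup ∅
  let s : X → Set ℝ := fun x => {t | ∃ f : G, f • y ≤ x ∧ τ (.ofMul f) = t}
  have hne : ∀ x, (s x).Nonempty := fun x =>
    let ⟨_, hn⟩ := exists_inv_pow_smul_lt hT y x
    ⟨_, _, hn.le, rfl⟩
  have hbdd : ∀ x, BddAbove (s x) := fun x => by
    obtain ⟨n, hn⟩ := exists_lt_pow_smul_of_forall_lt hT y x
    refine ⟨τ (.ofMul (T ^ n)), ?_⟩
    rintro _ ⟨f, hf, rfl⟩
    exact (hτ _ _ y).2 (hf.trans hn.le)
  have hle : ∀ (g : G) (x : X), sSup (s x) + τ (.ofMul g) ≤ sSup (s (g • x)) := fun g x => by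
    rw [← le_sub_iff_add_le]
    refine csSup_le (hne x) ?_
    rintro _ ⟨f, hf, rfl⟩
    rw [le_sub_iff_add_le', ← map_add]
    refine le_csSup (hbdd _) ⟨g * f, ?_, rfl⟩
    rw [mul_smul]
    exact smul_mono_right g hf
  refine ⟨fun x => sSup (s x), fun a b hab => ?_, fun g x => (hle g x).antisymm' ?_⟩
  · exact csSup_le_csSup (hbdd b) (hne a) fun _ ⟨f, hf, hft⟩ => ⟨f, hf.trans hab, hft⟩
  · have h := hle g⁻¹ (g • x)
    rwa [inv_smul_smul, ofMul_inv, map_neg, ← sub_eq_add_neg, sub_le_iff_le_add] at h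

/-- Otherwise the preimage under `Φ` of the fixed point of `t ↦ l * t + c` bounds a half-line whose
end is fixed by `k`, and then `k` acts trivially. -/
theorem eq_one_of_forall_apply_smul_eq {k : G}
    (hk : ∀ p : X, k • p = p → ∀ x : X, k • x = x) {Φ : X → ℝ} (hΦ : Monotone Φ)
    (hunbdd : ∀ t, (∃ x, Φ x < t) ∧ ∃ x, t < Φ x) {l c : ℝ} (hl : 0 < l)
    (hkΦ : ∀ x, Φ (k • x) = l * Φ x + c) : l = 1 := by
  by_contra hne
  obtain ⟨t, ht⟩ : ∃ t, l * t + c = t := ⟨c / (1 - l), by grind⟩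
  have hle : ∀ x, Φ (k • x) ≤ t ↔ Φ x ≤ t := fun x => by
    rw [hkΦ]
    conv_lhs => rw [← ht]
    rw [add_le_add_iff_right, mul_le_mul_iff_right₀ hl]
  obtain ⟨⟨a, ha⟩, b, hb⟩ := hunbdd t
  have hfix : k • sSup {x | Φ x ≤ t} = sSup {x | Φ x ≤ t} :=
    smul_csSup_eq_self ⟨a, ha.le⟩
      ⟨b, fun x hx => le_of_not_gt fun h => (hb.trans_le (hΦ h.le)).not_ge hx⟩
      (fun x hx => (hle x).2 hx)
      fun x hx => ⟨k⁻¹ • x, (hle _).1 (by rwa [smul_inv_smul]), (smul_inv_smul k x).ge⟩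
  have hkb := hkΦ b
  rw [hk _ hfix b] at hkb
  have hmul : (1 - l) * (Φ b - t) = 0 := by linarith
  exact mul_ne_zero (sub_ne_zero.2 (Ne.symm hne)) (sub_pos.2 hb).ne' hmul

end Order

end Developing

section Dichotomy

theorem dense_range_or_exists_eq_zsmul {A : Type*} [AddGroup A] (φ : A →+ ℝ) :
    Dense (Set.range φ) ∨ ∃ a, 0 ≤ φ a ∧ ∀ b, ∃ k : ℤ, φ b = φ (k • a) := by
  refine (AddSubgroup.dense_or_cyclic φ.range).imp id ?_
  rintro ⟨_, ha⟩
  obtain ⟨a, rfl⟩ : _ ∈ φ.range := ha ▸ AddSubgroup.mem_closure_singleton_self _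
  have hmem : ∀ b, ∃ k : ℤ, φ b = φ (k • a) := fun b => by
    have hb : φ b ∈ φ.range := ⟨b, rfl⟩
    rw [ha, AddSubgroup.mem_closure_singleton] at hb
    obtain ⟨k, hk⟩ := hb
    exact ⟨k, by rw [map_zsmul, hk]⟩
  rcases le_total 0 (φ a) with h | h
  · exact ⟨a, h, hmem⟩
  · refine ⟨-a, by simpa using h, fun b => ?_⟩
    obtain ⟨k, hk⟩ := hmem b
    exact ⟨-k, by simp [hk]⟩

variable {G X : Type*} [Group G] [ConditionallyCompleteLinearOrder X] [MulAction G X]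
  [CovariantClass G X HSMul.hSMul LE.le] {N : Subgroup G} {τ : Additive N →+ ℝ}

instance covariantClass_subgroup_smul_le :
    CovariantClass N X HSMul.hSMul LE.le where
  elim g _ _ h := smul_mono_right (g : G) h

/-- A developing map `Φ` of `N` extends along the subnormal series: if `g` normalizes a term that
acts affinely through `Φ`, then `x ↦ Φ (g • x)` develops `N` as well, hence is an affine function
of `Φ`. -/
theorem hasAffineDevelopingMap_of_dense (hN : N.IsSubnormal) (hsf : IsSemifreeAction N X)
    (hτ : IsTranslationHom X τ) (hdense : Dense (Set.range τ)) : HasAffineDevelopingMap G X := by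
  have : Nonempty X := ⟨sSup ∅⟩
  obtain ⟨_, ⟨T, rfl⟩, hT : 0 < τ (.ofMul T.toMul)⟩ := hdense.exists_gt 0
  obtain ⟨Φ, hΦ⟩ := hτ.exists_isDevelopingMap fun x => (hτ.map_pos_iff _ x).1 hT
  refine ⟨Φ, hΦ.monotone, hΦ.exists_ne hT, forall_of_isSubnormal hN
    (fun f hf => hΦ.actsAffinely (⟨f, hf⟩ : N)) fun M hNM hM g hgM => ?_⟩
  have hconj : ∀ f : N, ∃ c, ∀ x : X, Φ (g • f • x) = Φ (g • x) + c := fun f => by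
    obtain ⟨l, hl, c, hc⟩ := hM (g * f * g⁻¹) (hgM f (hNM f.2))
    have hk : ∀ p : X, (g * f * g⁻¹) • p = p → ∀ x : X, (g * f * g⁻¹) • x = x := fun p hp x =>
      conj_smul_eq_self_iff.2 (hsf f _ (conj_smul_eq_self_iff.1 hp :) _)
    obtain rfl : l = 1 :=
      eq_one_of_forall_apply_smul_eq hk hΦ.monotone (hΦ.exists_lt_and_exists_gt hT) hl hc
    refine ⟨c, fun x => ?_⟩
    simpa only [mul_smul, inv_smul_smul, one_mul, Subgroup.smul_def] using hc (g • x)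
  obtain ⟨τ', hτ'⟩ := exists_addMonoidHom_of_forall_exists_add (Ψ := fun x => Φ (g • x)) hconj
  obtain ⟨x, y, hxy⟩ := hΦ.exists_ne hT
  exact hΦ.exists_eq_mul_add hτ hdense hT ⟨hΦ.monotone.comp (smul_mono_right g), hτ'⟩
    ⟨g⁻¹ • x, g⁻¹ • y, by simpa only [smul_inv_smul] using hxy⟩

theorem IsTranslationHom.smul_le_conj_smul (hτ : IsTranslationHom X τ) {S : N}
    (hS : 0 ≤ τ (.ofMul S)) (hgen : ∀ f, ∃ k : ℤ, τ f = τ (k • .ofMul S)) {g : G}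
    (hg : g * S * g⁻¹ ∈ N) (x : X) : S • x ≤ (g * S * g⁻¹) • x := by
  suffices h : τ (.ofMul S) ≤ τ (.ofMul ⟨g * S * g⁻¹, hg⟩) from (hτ S ⟨_, hg⟩ x).1 h
  by_contra! hlt
  obtain ⟨k, hk⟩ := hgen (.ofMul ⟨g * S * g⁻¹, hg⟩)
  rw [hk, map_zsmul, zsmul_eq_mul] at hlt
  have hpos : 0 < τ (.ofMul S) := lt_of_le_of_ne hS fun h => by simp [← h] at hlt
  have hk1 : k < 1 := by exact_mod_cast (mul_lt_iff_lt_one_left hpos).1 hlt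
  have hk0 : (k : ℝ) ≤ 0 := by exact_mod_cast Int.lt_add_one_iff.1 hk1
  have hx : x < (g * S * g⁻¹ : G) • x := by
    rw [mul_smul, mul_smul, ← inv_smul_lt_iff_lt_smul]
    exact (hτ.map_pos_iff S _).1 hpos
  have hpos' := (hτ.map_pos_iff ⟨g * S * g⁻¹, hg⟩ x).2 hx
  rw [hk, map_zsmul, zsmul_eq_mul] at hpos'
  exact (mul_nonpos_of_nonpos_of_nonneg hk0 hS).not_gt hpos'

/-- The least translation in `N` is preserved by conjugation. -/
theorem IsTranslationHom.commutator_le_ker_toPermHom (hτ : IsTranslationHom X τ) {S : N}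
    (hS : 0 ≤ τ (.ofMul S)) (hgen : ∀ f, ∃ k : ℤ, τ f = τ (k • .ofMul S)) {P : Subgroup G}
    (hP : ∀ f ∈ N, ∀ g ∈ P, g * f * g⁻¹ ∈ N) :
    ⁅N, P⁆ ≤ (MulAction.toPermHom G X).ker := by
  set φ := MulAction.toPermHom G X
  have hcomm : ∀ g ∈ P, Commute (φ S) (φ g) := fun g hg => by
    have hconj : ∀ x : X, (S : G) • x = (g * S * g⁻¹) • x := fun x =>
      (hτ.smul_le_conj_smul hS hgen (hP S S.2 g hg) x).antisymm <| by
        have h := hτ.smul_le_conj_smul hS hgen (hP S S.2 g⁻¹ (P.inv_mem hg)) (g⁻¹ • x)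
        rw [inv_inv, mul_smul _ g, smul_inv_smul, mul_smul] at h
        rw [mul_smul, mul_smul]
        exact smul_le_iff_le_inv_smul.2 h
    refine Equiv.ext fun x => ?_
    have h := hconj (g • x)
    rwa [mul_smul _ g⁻¹, inv_smul_smul, mul_smul] at h
  refine Subgroup.commutator_le.2 fun f hf g hg => ?_
  obtain ⟨k, hk⟩ := hgen (.ofMul ⟨f, hf⟩)
  have hfS : φ f = φ S ^ k := by
    rw [← map_zpow]
    exact Equiv.ext (hτ.smul_eq (f := ⟨f, hf⟩) (g := S ^ k) hk)
  rw [MonoidHom.mem_ker, map_commutatorElement, commutatorElement_eq_one_iff_commute, hfS]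
  exact (hcomm g hg).zpow_left k

end Dichotomy

section CommonFixed

variable {G X : Type*} [Group G] [MulAction G X]

/-- Affine developing maps extend from an invariant subset through the retraction that sends `x`
to the last point of the subset before `x`. -/
theorem HasAffineDevelopingMap.of_subMulAction [LinearOrder X]
    [CovariantClass G X HSMul.hSMul LE.le] {Y : SubMulAction G X}
    (hY : ∀ x : X, ∃ y, IsGreatest {z ∈ Y | z ≤ x} y) (h : HasAffineDevelopingMap G Y) :
    HasAffineDevelopingMap G X := by
  obtain ⟨Φ, hΦ, ⟨a, b, hab⟩, haff⟩ := h
  choose r hr using hY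
  have hself : ∀ y : Y, r y = y := fun y => (hr y).1.2.antisymm ((hr y).2 ⟨y.2, le_rfl⟩)
  have hle : ∀ (g : G) (x : X), g • r x ≤ r (g • x) := fun g x =>
    (hr _).2 ⟨Y.smul_mem g (hr x).1.1, smul_mono_right g (hr x).1.2⟩
  have hsmul : ∀ (g : G) (x : X), r (g • x) = g • r x := fun g x =>
    (hle g x).antisymm' <| by simpa using smul_mono_right g (hle g⁻¹ (g • x))
  refine ⟨fun x => Φ ⟨r x, (hr x).1.1⟩, fun x y hxy => ?_, ⟨a, b, ?_⟩, fun g => ?_⟩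
  · exact hΦ ((hr y).2 ⟨(hr x).1.1, (hr x).1.2.trans hxy⟩)
  · simpa only [hself] using hab
  · obtain ⟨l, hl, c, hc⟩ := haff g
    refine ⟨l, hl, c, fun x => ?_⟩
    rw [← hc]
    exact congrArg Φ (Subtype.ext (hsmul g x))

variable (X) in
/-- The points fixed by all those conjugates of elements of `N` that have a fixed point. -/
def commonFixedPoints (N : Subgroup G) : SubMulAction G X where
  carrier := {x | ∀ f ∈ Group.conjugatesOfSet (N : Set G), (∃ p : X, f • p = p) → f • x = x}
  smul_mem' g x hx f hf := fun ⟨p, hp⟩ => by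
    have h := hx _ (Group.conj_mem_conjugatesOfSet (c := g⁻¹) hf)
      ⟨g⁻¹ • p, conj_smul_smul_eq_iff.2 hp⟩
    rwa [conj_smul_eq_self_iff, inv_inv] at h

theorem isSemifreeAction_commonFixedPoints (N : Subgroup G) :
    IsSemifreeAction N (commonFixedPoints X N) :=
  fun f p hp y => Subtype.ext <|
    y.2 f (Group.subset_conjugatesOfSet f.2) ⟨p, congrArg Subtype.val hp⟩

variable [ConditionallyCompleteLinearOrder X] [CovariantClass G X HSMul.hSMul LE.le]
  {N : Subgroup G}

theorem csSup_mem_commonFixedPoints {s : Set X} (hs : s ⊆ commonFixedPoints X N)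
    (hne : s.Nonempty) (hb : BddAbove s) : sSup s ∈ commonFixedPoints X N := fun f hf hp =>
  smul_csSup_eq_self hne hb (fun x hx => by rwa [hs hx f hf hp])
    fun x hx => ⟨x, hx, (hs hx f hf hp).ge⟩

theorem csInf_mem_commonFixedPoints {s : Set X} (hs : s ⊆ commonFixedPoints X N)
    (hne : s.Nonempty) (hb : BddBelow s) : sInf s ∈ commonFixedPoints X N :=
  csSup_mem_commonFixedPoints (X := Xᵒᵈ) hs hne hb

theorem exists_isGreatest_commonFixedPoints {T : G} (hT : ∀ x : X, x < T • x) {r : X}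
    (hr : r ∈ commonFixedPoints X N) (x : X) :
    ∃ y, IsGreatest {z ∈ commonFixedPoints X N | z ≤ x} y := by
  obtain ⟨n, hn⟩ := exists_inv_pow_smul_lt hT r x
  have hne : {z ∈ commonFixedPoints X N | z ≤ x}.Nonempty :=
    ⟨_, (commonFixedPoints X N).smul_mem _ hr, hn.le⟩
  have hb : BddAbove {z ∈ commonFixedPoints X N | z ≤ x} := ⟨x, fun z hz => hz.2⟩
  exact ⟨_, ⟨csSup_mem_commonFixedPoints (fun z hz => hz.1) hne hb,
    csSup_le hne fun z hz => hz.2⟩, fun z hz => le_csSup hb hz⟩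

end CommonFixed

section Main

variable {G : Type*} [Group G]

theorem IsSemifreeAction.hasAffineDevelopingMap {X : Type*} [ConditionallyCompleteLinearOrder X]
    [MulAction G X] [CovariantClass G X HSMul.hSMul LE.le] (hG : IsSemifreeAction G X) {T : G}
    (hT : ∀ x : X, x < T • x) : HasAffineDevelopingMap G X := by
  have : Nonempty X := ⟨sSup ∅⟩
  obtain ⟨τ, hτ⟩ := hG.exists_isTranslationHom
  obtain ⟨Φ, hΦ⟩ := hτ.exists_isDevelopingMap hT
  exact ⟨Φ, hΦ.monotone, hΦ.exists_ne ((hτ.map_pos_iff T (sSup ∅)).2 (hT _)), hΦ.actsAffinely⟩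

universe u

/-- It suffices to construct affine developing maps for actions that are semifree on `N`: pass to
the common fixed points of the conjugates of elements of `N` that have a fixed point. -/
theorem hasAffineDevelopingMap_of_forall_isSemifreeAction {N : Subgroup G} (hN : N.IsSubnormal)
    {X : Type u} [ConditionallyCompleteLinearOrder X] [MulAction G X]
    [CovariantClass G X HSMul.hSMul LE.le]
    (hfree : NoFreeSemigroupMod N (MulAction.toPermHom G X).ker) {T : G}
    (hT : ∀ x : X, x < T • x)
    (h : ∀ (Y : Type u) [ConditionallyCompleteLinearOrder Y] [MulAction G Y]
      [CovariantClass G Y HSMul.hSMul LE.le], (∀ y : Y, y < T • y) → IsSemifreeAction N Y →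
      NoFreeSemigroupMod N (MulAction.toPermHom G Y).ker → HasAffineDevelopingMap G Y) :
    HasAffineDevelopingMap G X := by
  obtain ⟨r, hr⟩ := exists_forall_smul_eq_self hN hfree hT
  let Y := commonFixedPoints X N
  let _ : Inhabited (Y : Set X) := ⟨⟨r, hr⟩⟩
  let _ : ConditionallyCompleteLinearOrder Y :=
    subsetConditionallyCompleteLinearOrder (Y : Set X)
      (fun hne hb => csSup_mem_commonFixedPoints (Subtype.coe_image_subset _ _)
        (hne.image _) ((Subtype.mono_coe _).map_bddAbove hb))
      fun hne hb => csInf_mem_commonFixedPoints (Subtype.coe_image_subset _ _)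
        (hne.image _) ((Subtype.mono_coe _).map_bddBelow hb)
  have : CovariantClass G Y HSMul.hSMul LE.le := ⟨fun g _ _ hab => smul_mono_right (α := X) g hab⟩
  have hker : (MulAction.toPermHom G X).ker ≤ (MulAction.toPermHom G Y).ker := fun g hg =>
    mem_ker_toPermHom.2 fun y => Subtype.ext (mem_ker_toPermHom.1 hg y)
  exact .of_subMulAction (exists_isGreatest_commonFixedPoints hT hr) <|
    h Y (fun y => hT y) (isSemifreeAction_commonFixedPoints N) (hfree.mono_right hker)

theorem HasNoFreeSemigroupSeries.hasAffineDevelopingMap {N : Subgroup G}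
    (hN : HasNoFreeSemigroupSeries N) {X : Type u} [ConditionallyCompleteLinearOrder X]
    [MulAction G X] [CovariantClass G X HSMul.hSMul LE.le]
    (hNX : NoFreeSemigroupMod N (MulAction.toPermHom G X).ker) {T : G}
    (hT : ∀ x : X, x < T • x) : HasAffineDevelopingMap G X := by
  induction hN generalizing X with
  | top =>
    exact hasAffineDevelopingMap_of_forall_isSemifreeAction .top hNX hT fun Y _ _ _ hT hsf _ =>
      IsSemifreeAction.hasAffineDevelopingMap (fun g => hsf ⟨g, Subgroup.mem_top g⟩) hT
  | @step P N hP hle hnormal hfree ih =>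
    have hN : N.IsSubnormal := (hP.step hle hnormal hfree).isSubnormal
    refine hasAffineDevelopingMap_of_forall_isSemifreeAction hN hNX hT fun Y _ _ _ hT hsf _ => ?_
    obtain ⟨τ, hτ⟩ := hsf.exists_isTranslationHom
    rcases dense_range_or_exists_eq_zsmul τ with hdense | ⟨S, hS, hgen⟩
    · exact hasAffineDevelopingMap_of_dense hN hsf hτ hdense
    · refine ih (hfree.of_commutator_le ?_) hT
      exact hτ.commutator_le_ker_toPermHom hS hgen fun f hf g hg =>
        (Subgroup.normal_subgroupOf_iff hle).1 hnormal f g hf hg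

end Main

section Measure

theorem rightLim_apply_eq_of_forall_apply_eq {Φ : ℝ → ℝ} (hΦ : Monotone Φ) {f : ℝ → ℝ}
    (hf : StrictMono f) (hcont : Continuous f) {l c : ℝ} (h : ∀ x, Φ (f x) = l * Φ x + c) (x : ℝ) :
    Function.rightLim Φ (f x) = l * Function.rightLim Φ x + c := by
  have hfx : Tendsto f (𝓝[>] x) (𝓝[>] f x) :=
    hcont.continuousWithinAt.tendsto_nhdsWithin fun _ hy => hf hy
  refine tendsto_nhds_unique ((hΦ.tendsto_rightLim (f x)).comp hfx) ?_
  simpa only [Function.comp_def, h] using ((hΦ.tendsto_rightLim x).const_mul l).add_const c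

theorem stieltjesFunction_measure_ne_zero {Φ : ℝ → ℝ} (hΦ : Monotone Φ)
    (hne : ∃ x y, Φ x ≠ Φ y) : hΦ.stieltjesFunction.measure ≠ 0 := by
  intro h0
  obtain ⟨x, y, hxy⟩ := hne
  wlog hlt : Φ x < Φ y generalizing x y
  · exact this y x hxy.symm (lt_of_le_of_ne (not_lt.1 hlt) hxy.symm)
  have hIoc := hΦ.stieltjesFunction.measure_Ioc (x - 1) y
  rw [h0, Measure.coe_zero, Pi.zero_apply, eq_comm, ENNReal.ofReal_eq_zero, sub_nonpos,
    hΦ.stieltjesFunction_eq, hΦ.stieltjesFunction_eq] at hIoc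
  exact (((hΦ.le_rightLim le_rfl).trans hIoc).trans (hΦ.rightLim_le (sub_one_lt x))).not_gt hlt

theorem map_stieltjesFunction_measure {Φ : ℝ → ℝ} (hΦ : Monotone Φ) (e : ℝ ≃o ℝ) {l c : ℝ}
    (hl : 0 ≤ l) (h : ∀ x, Φ (e.symm x) = l * Φ x + c) :
    hΦ.stieltjesFunction.measure.map e = ENNReal.ofReal l • hΦ.stieltjesFunction.measure := by
  refine (Measure.ext_of_Ioc' _ _ (fun a b _ => ?_) fun a b _ => ?_).symm
  · rw [Measure.smul_apply, StieltjesFunction.measure_Ioc, smul_eq_mul]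
    exact ENNReal.mul_ne_top ENNReal.ofReal_ne_top ENNReal.ofReal_ne_top
  · have hlim :=
      rightLim_apply_eq_of_forall_apply_eq hΦ e.symm.strictMono e.symm.continuous h
    rw [Measure.map_apply e.continuous.measurable measurableSet_Ioc, e.preimage_Ioc,
      Measure.smul_apply, StieltjesFunction.measure_Ioc, StieltjesFunction.measure_Ioc,
      smul_eq_mul, ← ENNReal.ofReal_mul hl]
    simp only [hΦ.stieltjesFunction_eq, hlim]
    congr 1
    ring

theorem HasAffineDevelopingMap.exists_quasiPreserves {G : Type*} [Group G] [MulAction G ℝ]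
    (h : HasAffineDevelopingMap G ℝ) {ρ : G →* (ℝ ≃ₜ ℝ)} (hρ : ∀ g : G, StrictMono (ρ g))
    (hsmul : ∀ (g : G) (x : ℝ), g • x = ρ g x) :
    ∃ μ : Measure ℝ, μ ≠ 0 ∧ IsFiniteMeasureOnCompacts μ ∧ QuasiPreserves ρ μ := by
  obtain ⟨Φ, hΦ, hne, haff⟩ := h
  refine ⟨_, stieltjesFunction_measure_ne_zero hΦ hne, inferInstance, fun g => ?_⟩
  let e : ℝ ≃o ℝ := { (ρ g).toEquiv with map_rel_iff' := (hρ g).le_iff_le }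
  obtain ⟨l, hl, c, hc⟩ := haff g⁻¹
  refine ⟨l, hl, map_stieltjesFunction_measure (c := c) hΦ e hl.le fun x => ?_⟩
  rw [← hc, hsmul, map_inv]
  rfl

end Measure

section ClassS

theorem finite_set_pow {M : Type*} [Monoid M] {s : Set M} (hs : s.Finite) (n : ℕ) :
    (s ^ n).Finite := by
  classical
  lift s to Finset M using hs
  rw [← Finset.coe_pow]
  exact Finset.finite_toSet _

theorem two_pow_le_ncard_pair_pow {M : Type*} [Monoid M] [IsLeftCancelMul M] {a b : M}
    (hab : ∀ n : ℕ, ∀ u ∈ ({a, b} : Set M) ^ n, ∀ v ∈ ({a, b} : Set M) ^ n, a * u ≠ b * v) :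
    ∀ n : ℕ, 2 ^ n ≤ (({a, b} : Set M) ^ n).ncard
  | 0 => by rw [pow_zero, pow_zero, ← Set.singleton_one, Set.ncard_singleton]
  | n + 1 => by
    set W := ({a, b} : Set M) ^ n with hW
    have hfin : W.Finite := finite_set_pow (Set.toFinite _) n
    have hsplit : ({a, b} : Set M) ^ (n + 1) = (a * ·) '' W ∪ (b * ·) '' W := by
      rw [pow_succ', ← hW, Set.insert_eq, Set.union_mul, Set.singleton_mul, Set.singleton_mul]
    have hdisj : Disjoint ((a * ·) '' W) ((b * ·) '' W) := by
      rw [Set.disjoint_left]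
      rintro _ ⟨u, hu, rfl⟩ ⟨v, hv, h⟩
      exact hab n u hu v hv h.symm
    rw [hsplit, Set.ncard_union_eq hdisj (hfin.image _) (hfin.image _),
      Set.ncard_image_of_injective _ (mul_right_injective a),
      Set.ncard_image_of_injective _ (mul_right_injective b), pow_succ, mul_two]
    exact add_le_add (two_pow_le_ncard_pair_pow hab n) (two_pow_le_ncard_pair_pow hab n)

theorem finite_growth_ball {K : Type*} [Group K] (S : Finset K) (n : ℕ) :
    ((insert 1 ((S : Set K) ∪ (S : Set K)⁻¹)) ^ n : Set K).Finite :=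
  finite_set_pow ((S.finite_toSet.union S.finite_toSet.inv).insert 1) n

theorem exists_mul_eq_mul_of_tendsto_growthFunction {K : Type*} [Group K] {S : Finset K}
    (hS : Tendsto (fun n : ℕ => (growthFunction S n : ℝ) ^ (1 / (n : ℝ))) atTop (𝓝 1)) {a b : K}
    (ha : a ∈ S) (hb : b ∈ S) :
    ∃ n : ℕ, ∃ u ∈ ({a, b} : Set K) ^ n, ∃ v ∈ ({a, b} : Set K) ^ n, a * u = b * v := by
  by_contra! hab
  have hle : ∀ n : ℕ, 2 ^ n ≤ growthFunction S n := fun n =>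
    (two_pow_le_ncard_pair_pow hab n).trans <| Set.ncard_le_ncard
      (Set.pow_subset_pow_left <| by rintro _ (rfl | rfl) <;> exact Or.inr (Or.inl ‹_›))
      (finite_growth_ball S n)
  have h21 : (2 : ℝ) ≤ 1 := ge_of_tendsto hS <| by
    filter_upwards [eventually_ne_atTop 0] with n hn
    calc (2 : ℝ) = ((2 : ℝ) ^ n) ^ (1 / (n : ℝ)) := by
          rw [one_div, Real.pow_rpow_inv_natCast zero_le_two hn]
      _ ≤ (growthFunction S n : ℝ) ^ (1 / (n : ℝ)) :=
          Real.rpow_le_rpow (by positivity) (by exact_mod_cast hle n) (by positivity)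
  norm_num at h21

theorem image_pair_pow {M N : Type*} [Monoid M] [Monoid N] (f : M →* N) (a b : M) (n : ℕ) :
    f '' ({a, b} ^ n) = {f a, f b} ^ n := by
  rw [Set.image_pow, Set.image_pair]

theorem HasLocallySubexponentialGrowth.exists_mul_eq_mul {K : Type*} [Group K]
    (hK : HasLocallySubexponentialGrowth K) (a b : K) :
    ∃ n : ℕ, ∃ u ∈ ({a, b} : Set K) ^ n, ∃ v ∈ ({a, b} : Set K) ^ n, a * u = b * v := by
  classical
  let H := Subgroup.closure ({a, b} : Set K)
  let a' : H := ⟨a, Subgroup.subset_closure (by simp)⟩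
  let b' : H := ⟨b, Subgroup.subset_closure (by simp)⟩
  have hgen : Subgroup.closure (({a', b'} : Finset H) : Set H) = ⊤ := by
    rw [← Subgroup.closure_closure_coe_preimage (k := ({a, b} : Set K))]
    congr 1
    ext x
    simp [a', b', Subtype.ext_iff]
  obtain ⟨n, u, hu, v, hv, h⟩ := exists_mul_eq_mul_of_tendsto_growthFunction
    ((hK H ⟨{a, b}, by simp [H]⟩).2 _ hgen) (a := a') (b := b') (by simp) (by simp)
  have hword := image_pair_pow H.subtype a' b' n
  exact ⟨n, u, hword ▸ ⟨u, hu, rfl⟩, v, hword ▸ ⟨v, hv, rfl⟩, congrArg Subtype.val h⟩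

theorem NoFreeSemigroupMod.of_hasLocallySubexponentialGrowth {G : Type*} [Group G]
    {P Q : Subgroup G} [(Q.subgroupOf P).Normal]
    (h : HasLocallySubexponentialGrowth (P ⧸ Q.subgroupOf P)) : NoFreeSemigroupMod P Q := by
  intro a ha b hb
  let a' : P := ⟨a, ha⟩
  let b' : P := ⟨b, hb⟩
  obtain ⟨n, _, hu, _, hv, heq⟩ := h.exists_mul_eq_mul (QuotientGroup.mk' _ a')
    (QuotientGroup.mk' _ b')
  rw [← image_pair_pow] at hu hv
  obtain ⟨u, hu, rfl⟩ := hu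
  obtain ⟨v, hv, rfl⟩ := hv
  have hword := image_pair_pow P.subtype a' b' n
  refine ⟨n, u, hword ▸ ⟨u, hu, rfl⟩, v, hword ▸ ⟨v, hv, rfl⟩, ?_⟩
  rw [← map_mul, ← map_mul] at heq
  exact Subgroup.mem_subgroupOf.1 (QuotientGroup.eq.1 heq)

theorem InClassS.hasNoFreeSemigroupSeries_bot {G : Type*} [Group G] (hG : InClassS G) :
    HasNoFreeSemigroupSeries (⊥ : Subgroup G) := by
  obtain ⟨n, F, h0, hn, hF⟩ := hG
  suffices h : ∀ i ≤ n, HasNoFreeSemigroupSeries (F i) from hn ▸ h n le_rfl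
  intro i
  induction i with
  | zero => exact fun _ => h0 ▸ .top
  | succ i ih =>
    intro hi
    obtain ⟨hle, hnormal, hgrowth⟩ := hF i hi
    exact .step (ih (Nat.le_of_succ_le hi)) hle hnormal
      (.of_hasLocallySubexponentialGrowth hgrowth)

end ClassS

section Solvable

open scoped IsMulCommutative

theorem ncard_coe_pow_le {M : Type*} [CommMonoid M] (A : Finset M) (n : ℕ) :
    ((A : Set M) ^ n).ncard ≤ (n + 1) ^ A.card := by
  classical
  let E : Finset (A → ℕ) := Fintype.piFinset fun _ => Finset.range (n + 1)
  have hE : E.card = (n + 1) ^ A.card := by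
    rw [Fintype.card_piFinset, Finset.prod_const, Finset.card_range, Finset.card_univ,
      Fintype.card_coe]
  have hsub : A ^ n ⊆ E.image fun e => ∏ a : A, (a : M) ^ e a := fun x hx => by
    obtain ⟨f, rfl⟩ := Finset.mem_pow.1 hx
    refine Finset.mem_image.2 ⟨fun a => Finset.card {i | f i = a}, ?_, ?_⟩
    · simp only [E, Fintype.mem_piFinset, Finset.mem_range, Nat.lt_succ_iff]
      exact fun a => (Finset.card_le_univ _).trans_eq (Fintype.card_fin n)
    · simp only [List.prod_ofFn, ← Finset.prod_const]
      exact Finset.prod_fiberwise' _ f fun a => (a : M)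
  rw [← Finset.coe_pow, Set.ncard_coe_finset, ← hE]
  exact (Finset.card_le_card hsub).trans Finset.card_image_le

theorem one_le_growthFunction {K : Type*} [Group K] (S : Finset K) (n : ℕ) :
    1 ≤ growthFunction S n :=
  (Set.ncard_pos (finite_growth_ball S n)).2 ⟨1, Set.one_mem_pow (Set.mem_insert _ _)⟩

theorem exists_growthFunction_le_pow {K : Type*} [Group K] [IsMulCommutative K]
    (S : Finset K) : ∃ d : ℕ, ∀ n, growthFunction S n ≤ (n + 1) ^ d := by
  classical
  refine ⟨(insert 1 (S ∪ S⁻¹)).card, fun n => ?_⟩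
  simpa [growthFunction] using ncard_coe_pow_le (insert 1 (S ∪ S⁻¹)) n

theorem tendsto_rpow_one_div_of_le_pow {u : ℕ → ℕ} {d : ℕ} (h1 : ∀ n, 1 ≤ u n)
    (hle : ∀ n, u n ≤ (n + 1) ^ d) :
    Tendsto (fun n : ℕ => (u n : ℝ) ^ (1 / (n : ℝ))) atTop (𝓝 1) := by
  have hlim : Tendsto (fun n : ℕ => (n + 1 : ℝ) ^ ((d : ℝ) / (1 * (n + 1 : ℝ) + -1)))
      atTop (𝓝 1) :=
    (tendsto_rpow_div_mul_add d 1 (-1) zero_ne_one).comp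
      (tendsto_atTop_add_const_right _ _ tendsto_natCast_atTop_atTop)
  refine tendsto_of_tendsto_of_tendsto_of_le_of_le tendsto_const_nhds hlim
    (fun n => Real.one_le_rpow (by exact_mod_cast h1 n) (by positivity)) fun n => ?_
  calc (u n : ℝ) ^ (1 / (n : ℝ)) ≤ ((n + 1 : ℝ) ^ d) ^ (1 / (n : ℝ)) :=
        Real.rpow_le_rpow (by positivity) (by exact_mod_cast hle n) (by positivity)
    _ = (n + 1 : ℝ) ^ ((d : ℝ) / (1 * (n + 1 : ℝ) + -1)) := by
        rw [← Real.rpow_natCast, ← Real.rpow_mul (by positivity), mul_one_div, one_mul,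
          add_neg_cancel_right]

theorem hasLocallySubexponentialGrowth_of_isMulCommutative (K : Type*) [Group K]
    [IsMulCommutative K] : HasLocallySubexponentialGrowth K := fun H hH =>
  ⟨(Group.fg_iff_subgroup_fg H).2 hH, fun S _ =>
    let ⟨_, hd⟩ := exists_growthFunction_le_pow S
    tendsto_rpow_one_div_of_le_pow (one_le_growthFunction S) hd⟩

theorem inClassS_of_isSolvable {G : Type*} [Group G] (h : Group.IsSolvable G) : InClassS G := by
  obtain ⟨n, hn⟩ := h.solvable
  refine ⟨n, derivedSeries G, rfl, hn, fun i _ => ⟨derivedSeries_antitone G i.le_succ,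
    (derivedSeries_normal G (i + 1)).subgroupOf _, ?_⟩⟩
  have hcomm : IsMulCommutative
      (derivedSeries G i ⧸ (derivedSeries G (i + 1)).subgroupOf (derivedSeries G i)) := by
    rw [Subgroup.Normal.quotient_commutative_iff_commutator_le, commutator_def,
      Subgroup.commutator_le]
    exact fun a _ b _ => Subgroup.mem_subgroupOf.2 (Subgroup.commutator_mem_commutator a.2 b.2)
  exact hasLocallySubexponentialGrowth_of_isMulCommutative _

end Solvable

theorem theoremA_general {G : Type*} [Group G] {N : Subgroup G} (hN : HasNoFreeSemigroupSeries N)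
    {ρ : G →* (ℝ ≃ₜ ℝ)} (hNρ : N ≤ ρ.ker) (hρ : ∀ g : G, StrictMono (ρ g)) {T : G}
    (hT : ∀ x : ℝ, ρ T x ≠ x) :
    ∃ μ : Measure ℝ, μ ≠ 0 ∧ IsFiniteMeasureOnCompacts μ ∧ QuasiPreserves ρ μ := by
  let _ : MulAction G ℝ :=
    { smul := fun g x => ρ g x
      one_smul := fun x => by change ρ 1 x = x; rw [map_one]; rfl
      mul_smul := fun g g' x => by change ρ (g * g') x = ρ g (ρ g' x); rw [map_mul]; rfl }
  have : CovariantClass G ℝ HSMul.hSMul LE.le := ⟨fun g _ _ h => (hρ g).monotone h⟩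
  have hNker : NoFreeSemigroupMod N (MulAction.toPermHom G ℝ).ker :=
    .of_le fun g hg => mem_ker_toPermHom.2 fun x => DFunLike.congr_fun (hNρ hg) x
  have hΦ : HasAffineDevelopingMap G ℝ :=
    (forall_lt_smul_or_forall_lt_inv_smul hT).elim (hN.hasAffineDevelopingMap hNker)
      (hN.hasAffineDevelopingMap hNker)
  exact hΦ.exists_quasiPreserves hρ fun _ _ => rfl

theorem theoremA {G : Type*} [Group G] :
    (Group.IsSolvable G → InClassS G) ∧
    (InClassS G →
      ∀ ρ : G →* (ℝ ≃ₜ ℝ), (∀ g : G, StrictMono (ρ g)) →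
        (∃ T : G, ∀ x : ℝ, ρ T x ≠ x) →
          ∃ μ : Measure ℝ, μ ≠ 0 ∧ IsFiniteMeasureOnCompacts μ ∧ QuasiPreserves ρ μ) := by
  exact ⟨inClassS_of_isSolvable, fun h _ hρ ⟨_, hT⟩ =>
    theoremA_general h.hasNoFreeSemigroupSeries_bot bot_le hρ hT⟩
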